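/- Let $\mathcal G$ be a directed graph (parallel edges allowed, no self-loops) with $n$ vertices and $m$ edges whose underlying undirected graph is a cycle of length $n=m\ge 2$; the directions of the individual edges are arbitrary. Let $B\in\mathbb R^{n\times m}$ be its incidence matrix ($B_{ij}=1$ if edge $j$ points to vertex $i$, $-1$ if edge $j$ originates from vertex $i$, and $0$ otherwise). Let $H:\mathbb R^n\to\mathbb R$ be twice continuously differentiable and radially unbounded, with positive definite Hessian matrix at every point. Let $u^-,u^+\in\mathbb R^m$ satisfy $u_i^-<u_i^+$ for all $i$, and let the orientation be compatible with the constraint intervals $[u_i^-,u_i^+]$, that is, $u_i^-\ge 0$ and $u_i^+>0$ for all $i$. For $z\in\mathbb R^m$ let $\operatorname{sat}(z;u^-,u^+)_i$ be $u_i^-$ if $z_i\le u_i^-$, $z_i$ if $u_i^-<z_i<u_i^+$, and $u_i^+$ if $z_i\ge u_i^+$. Consider the closed-loop system \[ \dot x = B\,\operatorname{sat}\Big(-B^{T}\frac{\partial H}{\partial x}(x)-x_c;\,u^-,u^+\Big),\qquad \dot x_c = B^{T}\frac{\partial H}{\partial x}(x). \] Then all trajectories $(x(t),x_c(t))$, $t\ge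 0$, of this system converge (in distance, as $t\to\infty$) to the set \[ \mathcal E_{\mathrm{tot}}=\Big\{(x,x_c)\ \Big|\ \frac{\partial H}{\partial x}(x)=\alpha\mathbb 1_n \text{ for some } \alpha\in\mathbb R,\ \ B\,\operatorname{sat}(-x_c;u^-,u^+)=0\Big\} \] if and only if $\mathcal G$ is strongly connected and the intersection $\bigcap_{i=1}^m[u_i^-,u_i^+]$ of all the constraint intervals is an interval with non-empty interior. (When $\mathcal E_{\mathrm{tot}}$ is empty, no trajectory converges to it.) -/

import Mathlib

open Set Filter Topology

noncomputable section

/-- A directed graph (parallel edges allowed, self-loops not) with vertices `V` and edges `E`;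
every edge runs from its tail to its head. -/
structure FlowGraph (V E : Type*) where
  tail : E → V
  head : E → V
  tail_ne_head : ∀ e, tail e ≠ head e

namespace FlowGraph

variable {V E : Type*}

/-- The incidence matrix. -/
def incidence [DecidableEq V] (G : FlowGraph V E) : Matrix V E ℝ :=
  Matrix.of fun i e => if G.head e = i then 1 else if G.tail e = i then -1 else 0

/-- There is an edge from `v` to `w`. -/
def Step (G : FlowGraph V E) (v w : V) : Prop :=
  ∃ e, G.tail e = v ∧ G.head e = w

/-- Every vertex can be reached from every vertex along directed edges. -/
def StronglyConnected (G : FlowGraph V E) : Prop :=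
  ∀ v w, Relation.ReflTransGen G.Step v w

/-- The underlying undirected graph is a cycle of some length `n ≥ 2`: vertices and edges can be
numbered cyclically so that the `i`-th edge joins the `i`-th and the `(i+1)`-st vertex. The
direction of each edge is arbitrary. -/
def IsCycle (G : FlowGraph V E) : Prop :=
  ∃ n : ℕ, 2 ≤ n ∧ ∃ (v : ZMod n ≃ V) (e : ZMod n ≃ E), ∀ i : ZMod n,
    (G.tail (e i) = v i ∧ G.head (e i) = v (i + 1)) ∨
    (G.tail (e i) = v (i + 1) ∧ G.head (e i) = v i)

end FlowGraph

/-- The saturation function, componentwise. -/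
def sat {E : Type*} (z a b : E → ℝ) : E → ℝ :=
  fun e => if z e ≤ a e then a e else if z e < b e then z e else b e

/-- The column vector of partial derivatives of `H` at `x`. -/
def gradVec {V : Type*} [Fintype V] [DecidableEq V] (H : (V → ℝ) → ℝ) (x : V → ℝ) : V → ℝ :=
  fun i => fderiv ℝ H x (Pi.single i 1)

/-- The Hessian matrix of `H` at `x`. -/
def hessianMatrix {V : Type*} [Fintype V] [DecidableEq V] (H : (V → ℝ) → ℝ) (x : V → ℝ) :
    Matrix V V ℝ :=
  Matrix.of fun i j => fderiv ℝ (fun y => gradVec H y i) x (Pi.single j 1)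

/-- The orientation of the graph is compatible with the constraint intervals. -/
def CompatibleWithConstraints {E : Type*} (um up : E → ℝ) : Prop :=
  (∀ e, 0 < up e) ∧ ∀ e, 0 ≤ um e

namespace FlowGraph

variable {V E : Type*} [Fintype V] [DecidableEq V] [Fintype E]

open Matrix in
/-- `(x, xc)` is a trajectory on `[0, ∞)` of the saturated PI closed loop
`x' = B sat(-Bᵀ ∂H/∂x(x) - xc; um, up)`, `xc' = Bᵀ ∂H/∂x(x)`. -/
def IsTrajectory (G : FlowGraph V E) (H : (V → ℝ) → ℝ) (um up : E → ℝ)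
    (x : ℝ → V → ℝ) (xc : ℝ → E → ℝ) : Prop :=
  ∀ t, 0 ≤ t →
    HasDerivWithinAt x
      (G.incidence *ᵥ sat (-(G.incidenceᵀ *ᵥ gradVec H (x t)) - xc t) um up) (Ici 0) t ∧
    HasDerivWithinAt xc (G.incidenceᵀ *ᵥ gradVec H (x t)) (Ici 0) t

open Matrix in
/-- The load balancing set. -/
def loadBalancingSet (G : FlowGraph V E) (H : (V → ℝ) → ℝ) (um up : E → ℝ) :
    Set ((V → ℝ) × (E → ℝ)) :=
  {p | (∃ α : ℝ, gradVec H p.1 = fun _ => α) ∧ G.incidence *ᵥ sat (-p.2) um up = 0}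

end FlowGraph

/-- The curve `p` converges to the set `S`: its distance to `S` tends to `0` as `t → ∞` (never the
case when `S` is empty). -/
def ConvergesToSet {X : Type*} [PseudoMetricSpace X] (p : ℝ → X) (S : Set X) : Prop :=
  ∀ ε > 0, ∀ᶠ t in atTop, ∃ q ∈ S, dist (p t) q < ε

end

/-! Sufficiency. On a strongly connected cycle a constant flow `c` is a circulation. Choose `c`
inside all intervals, put `z = -Bᵀ∇H(x) - xc`, and take as Lyapunov function `H(x)` plus the sum of
the primitives of `sat(s) - c` at `z_e`. Its derivative is minus the Hessian form at `x' = B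
sat(z)`, and its sublevel sets are bounded in `(x, z)`: `H` is radially unbounded, and since `c` is
interior the controller terms grow linearly. A Barbalat argument gives `x' → 0`; hence `y = Bᵀ∇H(x)`
has vanishing derivative, and being the derivative of the bounded `xc` it tends to `0` as well.
Compactness turns this into convergence to the set (`IsTrajectory.convergesToSet`).

Necessity. Some trajectory exists (`exists_isTrajectory`), so convergence makes the target set
nonempty and yields an admissible circulation `u`. If the graph is not strongly connected, or some
`um i ≥ up j`, there is a potential `p` with `Bᵀp ≠ 0` such that moving the controller output along
`-Bᵀp` never changes the saturated flow `u`. Fixing `x` with `∇H(x) = ε p` then gives a trajectory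
with constant `x` that is not balanced (`transpose_incidence_mulVec_eq_zero_of_drift`). -/

open scoped NNReal

noncomputable section

namespace FlowGraph

open Matrix

/-! ### Incidence matrices, and circulations on a cycle. -/

section Incidence

variable {V E : Type*} [DecidableEq V]

lemma incidence_apply (G : FlowGraph V E) (i : V) (e : E) :
    G.incidence i e = (if G.head e = i then 1 else 0) - (if G.tail e = i then 1 else 0) := by
  have h := G.tail_ne_head e
  simp only [incidence, of_apply]
  split_ifs with h1 h2 <;> simp_all

lemma transpose_incidence_mulVec [Fintype V] (G : FlowGraph V E) (p : V → ℝ) (e : E) :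
    (G.incidenceᵀ *ᵥ p) e = p (G.head e) - p (G.tail e) := by
  simp [mulVec, dotProduct, incidence_apply, sub_mul, Finset.sum_sub_distrib]

lemma dotProduct_incidence_mulVec [Fintype V] [Fintype E] (G : FlowGraph V E)
    (p : V → ℝ) (u : E → ℝ) :
    p ⬝ᵥ (G.incidence *ᵥ u) = (G.incidenceᵀ *ᵥ p) ⬝ᵥ u := by
  rw [dotProduct_mulVec, mulVec_transpose]

end Incidence

lemma StronglyConnected.eq_of_transpose_incidence_mulVec_eq_zero {V E : Type*} [Fintype V]
    [DecidableEq V] {G : FlowGraph V E} (hG : G.StronglyConnected) {p : V → ℝ}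
    (hp : G.incidenceᵀ *ᵥ p = 0) (v w : V) : p v = p w := by
  induction hG v w with
  | refl => rfl
  | tail _ h ih =>
    obtain ⟨e, rfl, rfl⟩ := h
    have := congrFun hp e
    rw [transpose_incidence_mulVec] at this
    rw [ih, eq_comm, ← sub_eq_zero]
    exact this

lemma zmod_apply_eq_of_apply_add_one {n : ℕ} [NeZero n] {α : Type*} {c : ZMod n → α}
    (h : ∀ i, c (i + 1) = c i) (i : ZMod n) : c i = c 0 := by
  have key : ∀ k : ℕ, c (k : ZMod n) = c 0 := by
    intro k
    induction k with
    | zero => simp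
    | succ k ih => rw [Nat.cast_succ, h, ih]
  rw [← ZMod.natCast_zmod_val i, key]

/-- A cyclic numbering of vertices and edges; `σ i` records the direction of the `i`-th edge. -/
structure CyclicNumbering {V E : Type*} (G : FlowGraph V E) (n : ℕ) where
  v : ZMod n ≃ V
  e : ZMod n ≃ E
  σ : ZMod n → ℝ
  edge : ∀ i, (σ i = 1 ∧ G.tail (e i) = v i ∧ G.head (e i) = v (i + 1)) ∨
    (σ i = -1 ∧ G.tail (e i) = v (i + 1) ∧ G.head (e i) = v i)

lemma IsCycle.exists_cyclicNumbering {V E : Type*} {G : FlowGraph V E} (hG : G.IsCycle) :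
    ∃ n : ℕ, 2 ≤ n ∧ Nonempty (G.CyclicNumbering n) := by
  classical
  obtain ⟨n, hn, v, e, h⟩ := hG
  refine ⟨n, hn, ⟨⟨v, e, fun i => if G.tail (e i) = v i then 1 else -1, fun i => ?_⟩⟩⟩
  by_cases hi : G.tail (e i) = v i
  · rcases h i with h' | h'
    · exact Or.inl ⟨if_pos hi, h'⟩
    · exact absurd (hi.trans h'.2.symm) (G.tail_ne_head _)
  · rcases h i with h' | h'
    · exact absurd h'.1 hi
    · exact Or.inr ⟨if_neg hi, h'⟩

namespace CyclicNumbering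

variable {V E : Type*} {G : FlowGraph V E} {n : ℕ} (C : G.CyclicNumbering n)
include C

lemma σ_ne_zero (i : ZMod n) : C.σ i ≠ 0 := by
  rcases C.edge i with h | h <;> rw [h.1] <;> norm_num

lemma apply_head_sub_apply_tail (f : V → ℝ) (i : ZMod n) :
    f (G.head (C.e i)) - f (G.tail (C.e i)) = C.σ i * (f (C.v (i + 1)) - f (C.v i)) := by
  rcases C.edge i with h | h <;> rw [h.1, h.2.1, h.2.2] <;> ring

lemma incidence_mulVec [NeZero n] [Fintype V] [DecidableEq V] [Fintype E] (u : E → ℝ)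
    (i : ZMod n) :
    (G.incidence *ᵥ u) (C.v (i + 1)) =
      C.σ i * u (C.e i) - C.σ (i + 1) * u (C.e (i + 1)) := by
  have h := G.dotProduct_incidence_mulVec (Pi.single (C.v (i + 1)) 1) u
  rw [single_one_dotProduct] at h
  rw [h, dotProduct, ← C.e.sum_comp]
  simp only [transpose_incidence_mulVec, C.apply_head_sub_apply_tail]
  simp only [Pi.single_apply, C.v.injective.eq_iff, add_left_inj, mul_sub, sub_mul, Finset.sum_sub_distrib]
  simp

/-- Flow conservation at the vertex shared by two consecutive edges equates their signed flows, so
the kernel of `B` is at most a line, and a nonzero circulation vanishes on no edge. -/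
lemma σ_mul_eq_of_incidence_mulVec_eq_zero [NeZero n] [Fintype V] [DecidableEq V] [Fintype E]
    {u : E → ℝ} (hu : G.incidence *ᵥ u = 0) (i : ZMod n) :
    C.σ i * u (C.e i) = C.σ 0 * u (C.e 0) := by
  refine zmod_apply_eq_of_apply_add_one (c := fun i => C.σ i * u (C.e i)) (fun i => ?_) i
  have := C.incidence_mulVec u i
  rw [hu] at this
  simp only [Pi.zero_apply] at this
  linarith

/-- If the direction changed at `v (i + 1)`, that vertex would be a sink or a source, so no path
could leave it or none could enter it. -/
lemma σ_add_one (hG : G.StronglyConnected) (i : ZMod n) : C.σ (i + 1) = C.σ i := by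
  have hne : C.v i ≠ C.v (i + 1) := by
    have := G.tail_ne_head (C.e i)
    rcases C.edge i with h | h
    · rwa [h.2.1, h.2.2] at this
    · rw [h.2.1, h.2.2] at this; exact this.symm
  rcases C.edge i with h | h <;> rcases C.edge (i + 1) with h' | h'
  · rw [h.1, h'.1]
  · exfalso
    rcases (hG (C.v (i + 1)) (C.v i)).cases_head with h0 | ⟨w, ⟨e, he, -⟩, -⟩
    · exact hne h0.symm
    · obtain ⟨k, rfl⟩ := C.e.surjective e
      rcases C.edge k with hk | hk
      · have : k = i + 1 := C.v.injective (hk.2.1.symm.trans he)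
        rw [← this, hk.1] at h'; norm_num at h'
      · have : k = i := add_right_cancel (C.v.injective (hk.2.1.symm.trans he))
        rw [← this, hk.1] at h; norm_num at h
  · exfalso
    rcases (hG (C.v i) (C.v (i + 1))).cases_tail with h0 | ⟨w, -, ⟨e, -, he⟩⟩
    · exact hne h0.symm
    · obtain ⟨k, rfl⟩ := C.e.surjective e
      rcases C.edge k with hk | hk
      · have : k = i := add_right_cancel (C.v.injective (hk.2.2.symm.trans he))
        rw [← this, hk.1] at h; norm_num at h
      · have : k = i + 1 := C.v.injective (hk.2.2.symm.trans he)
        rw [← this, hk.1] at h'; norm_num at h'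
  · rw [h.1, h'.1]

end CyclicNumbering

namespace IsCycle

lemma nonempty_edges {V E : Type*} {G : FlowGraph V E} (hG : G.IsCycle) : Nonempty E := by
  obtain ⟨n, -, -, e, -⟩ := hG
  exact ⟨e 0⟩

variable {V E : Type*} [Fintype V] [DecidableEq V] {G : FlowGraph V E} (hG : G.IsCycle)
include hG

lemma eq_of_transpose_incidence_mulVec_eq_zero {p : V → ℝ} (hp : G.incidenceᵀ *ᵥ p = 0)
    (v w : V) : p v = p w := by
  obtain ⟨n, hn, ⟨C⟩⟩ := hG.exists_cyclicNumbering
  have : NeZero n := ⟨by omega⟩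
  have key : ∀ i, p (C.v i) = p (C.v 0) :=
    zmod_apply_eq_of_apply_add_one (c := fun i => p (C.v i)) fun i => by
      have := congrFun hp (C.e i)
      rw [transpose_incidence_mulVec, C.apply_head_sub_apply_tail, Pi.zero_apply,
        mul_eq_zero] at this
      exact sub_eq_zero.1 (this.resolve_left (C.σ_ne_zero i))
  obtain ⟨i, rfl⟩ := C.v.surjective v
  obtain ⟨j, rfl⟩ := C.v.surjective w
  rw [key, key j]

/-- Take the indicator of the set reachable from `v`: no edge leaves this set, so the potential
never drops along an edge, and it is not constant because `w` is outside. -/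
lemma exists_transpose_incidence_mulVec_nonneg (hs : ¬ G.StronglyConnected) :
    ∃ p : V → ℝ, 0 ≤ G.incidenceᵀ *ᵥ p ∧ G.incidenceᵀ *ᵥ p ≠ 0 := by
  classical
  simp only [StronglyConnected, not_forall] at hs
  obtain ⟨v, w, hvw⟩ := hs
  refine ⟨fun x => if Relation.ReflTransGen G.Step v x then 1 else 0, fun e => ?_, fun h => ?_⟩
  · rw [transpose_incidence_mulVec, Pi.zero_apply, sub_nonneg]
    split_ifs with h1 h2 h2
    · rfl
    · exact absurd (h1.tail ⟨e, rfl, rfl⟩) h2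
    · norm_num
    · rfl
  · have := hG.eq_of_transpose_incidence_mulVec_eq_zero h v w
    simp only [hvw, if_false, Relation.ReflTransGen.refl, if_true] at this
    norm_num at this

variable [Fintype E]

lemma eq_zero_of_incidence_mulVec_eq_zero {u : E → ℝ} (hu : G.incidence *ᵥ u = 0) {e₀ : E}
    (h₀ : u e₀ = 0) : u = 0 := by
  obtain ⟨n, hn, ⟨C⟩⟩ := hG.exists_cyclicNumbering
  have : NeZero n := ⟨by omega⟩
  have key := C.σ_mul_eq_of_incidence_mulVec_eq_zero hu
  obtain ⟨k, rfl⟩ := C.e.surjective e₀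
  have hz : C.σ 0 * u (C.e 0) = 0 := by rw [← key k, h₀, mul_zero]
  ext e
  obtain ⟨i, rfl⟩ := C.e.surjective e
  have := key i
  rw [hz, mul_eq_zero] at this
  exact this.resolve_left (C.σ_ne_zero i)

lemma incidence_mulVec_const (hs : G.StronglyConnected) (c : ℝ) :
    G.incidence *ᵥ (fun _ => c) = 0 := by
  obtain ⟨n, hn, ⟨C⟩⟩ := hG.exists_cyclicNumbering
  have : NeZero n := ⟨by omega⟩
  ext w
  obtain ⟨i, rfl⟩ := C.v.surjective w
  have := C.incidence_mulVec (fun _ => c) (i - 1)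
  rw [C.σ_add_one hs, sub_self, sub_add_cancel] at this
  exact this

lemma eq_const_of_incidence_mulVec_eq_zero (hs : G.StronglyConnected) {u : E → ℝ}
    (hu : G.incidence *ᵥ u = 0) (e e' : E) : u e = u e' := by
  have h : G.incidence *ᵥ (u - fun _ => u e') = 0 := by
    rw [mulVec_sub, hu, hG.incidence_mulVec_const hs, sub_zero]
  have := congrFun (hG.eq_zero_of_incidence_mulVec_eq_zero h (e₀ := e') (by simp)) e
  exact sub_eq_zero.1 this

/-- The range of `Bᵀ` is the annihilator of the circulations. These are constant here, hence
orthogonal to the difference of two unit vectors. -/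
lemma exists_transpose_incidence_mulVec_eq [DecidableEq E] (hs : G.StronglyConnected) (i j : E) :
    ∃ p : V → ℝ, G.incidenceᵀ *ᵥ p = Pi.single i 1 - Pi.single j 1 := by
  by_contra hcon
  have hn : (Pi.single i 1 - Pi.single j 1 : E → ℝ) ∉
      LinearMap.range (G.incidenceᵀ.mulVecLin) := by
    rintro ⟨p, hp⟩
    exact hcon ⟨p, hp⟩
  obtain ⟨f, hf, hle⟩ := Submodule.exists_le_ker_of_notMem hn
  set u : E → ℝ := fun e => f (Pi.single e 1) with hu
  have hfu : ∀ z : E → ℝ, f z = z ⬝ᵥ u := by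
    intro z
    conv_lhs => rw [pi_eq_sum_univ' z]
    simp [dotProduct, hu, map_sum]
  have hBu : G.incidence *ᵥ u = 0 := by
    refine dotProduct_eq_zero _ fun p => ?_
    rw [dotProduct_comm, dotProduct_incidence_mulVec, ← hfu]
    exact hle ⟨p, rfl⟩
  apply hf
  rw [map_sub, sub_eq_zero]
  exact hG.eq_const_of_incidence_mulVec_eq_zero hs hBu i j

end IsCycle

end FlowGraph

/-! ### The saturation function and its convex primitive. -/

section Saturation

variable {E : Type*}

lemma sat_apply {a b : E → ℝ} {e : E} (h : a e < b e) (z : E → ℝ) :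
    sat z a b e = max (a e) (min (z e) (b e)) := by
  unfold sat
  split_ifs with h1 h2
  · rw [max_eq_left (min_le_of_left_le h1)]
  · rw [min_eq_left h2.le, max_eq_right (not_le.1 h1).le]
  · rw [min_eq_right (not_lt.1 h2), max_eq_right h.le]

lemma sat_mem_Icc {a b : E → ℝ} (h : ∀ e, a e < b e) (z : E → ℝ) (e : E) :
    sat z a b e ∈ Icc (a e) (b e) := by
  rw [sat_apply (h e)]
  exact ⟨le_max_left _ _, max_le (h e).le (min_le_right _ _)⟩

lemma sat_eq_of_le {a b : E → ℝ} {e : E} {z : E → ℝ} (h : z e ≤ a e) : sat z a b e = a e :=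
  if_pos h

lemma sat_eq_of_ge {a b : E → ℝ} (h : ∀ e, a e < b e) {e : E} {z : E → ℝ} (hz : b e ≤ z e) :
    sat z a b e = b e := by
  rw [sat_apply (h e), min_eq_right hz, max_eq_right (h e).le]

lemma sat_eq_self {a b : E → ℝ} (h : ∀ e, a e < b e) {e : E} {z : E → ℝ}
    (hz : z e ∈ Icc (a e) (b e)) : sat z a b e = z e := by
  rw [sat_apply (h e), min_eq_left hz.2, max_eq_right hz.1]

lemma lipschitzWith_sat [Fintype E] {a b : E → ℝ} (h : ∀ e, a e < b e) :
    LipschitzWith 1 (fun z : E → ℝ => sat z a b) := by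
  refine LipschitzWith.of_dist_le_mul fun z w => ?_
  rw [NNReal.coe_one, one_mul]
  refine (dist_pi_le_iff dist_nonneg).2 fun e => ?_
  simp only [sat_apply (h e), Real.dist_eq]
  refine (abs_max_sub_max_le_max _ _ _ _).trans ?_
  rw [sub_self, abs_zero, max_eq_right (abs_nonneg _)]
  refine (abs_min_sub_min_le_max _ _ _ _).trans ?_
  rw [sub_self, abs_zero, max_eq_left (abs_nonneg _), ← Real.dist_eq]
  exact dist_le_pi_dist z w e

/-- A primitive of the scalar saturation function. -/
def satPrimitive (a b z : ℝ) : ℝ := ∫ s in (0 : ℝ)..z, max a (min s b)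

lemma hasDerivAt_satPrimitive (a b z : ℝ) :
    HasDerivAt (satPrimitive a b) (max a (min z b)) z := by
  have hc : Continuous fun s : ℝ => max a (min s b) := by fun_prop
  exact intervalIntegral.integral_hasDerivAt_right (hc.intervalIntegrable _ _)
    (hc.stronglyMeasurableAtFilter _ _) hc.continuousAt

/-- This is the tangent inequality of a convex function: the integrand is monotone and takes the
value `d` at `d`. -/
lemma mul_sub_le_satPrimitive_sub {a b d : ℝ} (hd : d ∈ Icc a b) (z : ℝ) :
    d * (z - d) ≤ satPrimitive a b z - satPrimitive a b d := by
  have hc : Continuous fun s : ℝ => max a (min s b) := by fun_prop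
  rw [satPrimitive, satPrimitive, intervalIntegral.integral_interval_sub_left
    (hc.intervalIntegrable _ _) (hc.intervalIntegrable _ _)]
  rcases le_total d z with h | h
  · have := intervalIntegral.integral_mono_on (μ := MeasureTheory.volume) h
      (f := fun _ => d)
      (g := fun s => max a (min s b)) intervalIntegrable_const (hc.intervalIntegrable _ _)
      fun s hs => le_max_of_le_right (le_min hs.1 hd.2)
    simp only [intervalIntegral.integral_const, smul_eq_mul] at this
    linarith
  · have := intervalIntegral.integral_mono_on (μ := MeasureTheory.volume) h
      (g := fun _ => d)
      (f := fun s => max a (min s b)) (hc.intervalIntegrable _ _) intervalIntegrable_const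
      fun s hs => max_le hd.1 (min_le_of_left_le hs.2)
    rw [intervalIntegral.integral_symm]
    simp only [intervalIntegral.integral_const, smul_eq_mul] at this
    linarith

/-- If `c` lies strictly inside the constraint interval, the shifted primitive grows linearly. -/
lemma exists_satPrimitive_lower_bound {a b c : ℝ} (hc : c ∈ Ioo a b) :
    ∃ δ > 0, ∃ K, ∀ z, δ * |z| - K ≤ satPrimitive a b z - c * z := by
  obtain ⟨δ, hδ, h1, h2⟩ : ∃ δ > 0, a ≤ c - δ ∧ c + δ ≤ b :=
    ⟨min (c - a) (b - c), lt_min (sub_pos.2 hc.1) (sub_pos.2 hc.2),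
      by linarith [min_le_left (c - a) (b - c)], by linarith [min_le_right (c - a) (b - c)]⟩
  -- Use the two tangents of slopes `c + δ` and `c - δ`; the constant absorbs both intercepts.
  refine ⟨δ, hδ, |satPrimitive a b (c + δ) - (c + δ) * (c + δ)| +
    |satPrimitive a b (c - δ) - (c - δ) * (c - δ)|, fun z => ?_⟩
  have hp := mul_sub_le_satPrimitive_sub (a := a) (b := b) (d := c + δ)
    ⟨by linarith, h2⟩ z
  have hm := mul_sub_le_satPrimitive_sub (a := a) (b := b) (d := c - δ)
    ⟨h1, by linarith⟩ z
  have e1 := neg_abs_le (satPrimitive a b (c + δ) - (c + δ) * (c + δ))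
  have e2 := neg_abs_le (satPrimitive a b (c - δ) - (c - δ) * (c - δ))
  have e3 := abs_nonneg (satPrimitive a b (c + δ) - (c + δ) * (c + δ))
  have e4 := abs_nonneg (satPrimitive a b (c - δ) - (c - δ) * (c - δ))
  rcases abs_cases z with ⟨h, -⟩ | ⟨h, -⟩ <;> rw [h] <;> linarith

end Saturation

/-! ### Asymptotics of curves on the half-line. -/

section Asymptotics

lemma exists_deriv_eq_slope_of_hasDerivWithinAt_Ici {f f' : ℝ → ℝ}
    (hf : ∀ t, 0 ≤ t → HasDerivWithinAt f (f' t) (Ici 0) t) {s t : ℝ} (hs : 0 ≤ s) (hst : s < t) :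
    ∃ c ∈ Ioo s t, f' c = (f t - f s) / (t - s) :=
  exists_hasDerivAt_eq_slope f f' hst
    (fun x hx => ((hf x (hs.trans hx.1)).continuousWithinAt).mono
      fun _ hy => hs.trans hy.1)
    fun x hx => (hf x (hs.trans hx.1.le)).hasDerivAt (Ici_mem_nhds (hs.trans_lt hx.1))

lemma antitoneOn_of_hasDerivWithinAt_Ici {f f' : ℝ → ℝ}
    (hf : ∀ t, 0 ≤ t → HasDerivWithinAt f (f' t) (Ici 0) t) (hf' : ∀ t, 0 ≤ t → f' t ≤ 0) :
    AntitoneOn f (Ici 0) := by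
  intro s hs t _ hst
  rcases hst.eq_or_lt with rfl | hst
  · rfl
  · obtain ⟨c, hc, h⟩ := exists_deriv_eq_slope_of_hasDerivWithinAt_Ici hf hs hst
    have := hf' c (le_trans hs hc.1.le)
    rw [h, div_le_iff₀ (sub_pos.2 hst), zero_mul] at this
    linarith

lemma dist_le_of_hasDerivWithinAt_Ici {F : Type*} [NormedAddCommGroup F] [NormedSpace ℝ F]
    {f f' : ℝ → F} (hf : ∀ t, 0 ≤ t → HasDerivWithinAt f (f' t) (Ici 0) t) {L : ℝ}
    (hL : ∀ t, 0 ≤ t → ‖f' t‖ ≤ L) {s t : ℝ} (hs : 0 ≤ s) (ht : 0 ≤ t) :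
    dist (f s) (f t) ≤ L * dist s t := by
  rw [dist_eq_norm, dist_eq_norm]
  exact Convex.norm_image_sub_le_of_norm_hasDerivWithin_le (s := Ici 0) hf hL (convex_Ici 0) ht hs

/-- A Barbalat type lemma: the dissipation of a Lyapunov function which is bounded from below
vanishes asymptotically. -/
lemma tendsto_zero_of_dissipation {F : Type*} [NormedAddCommGroup F] {f f' : ℝ → ℝ} {g : ℝ → F}
    {c L m : ℝ} (hc : 0 < c)
    (hf : ∀ t, 0 ≤ t → HasDerivWithinAt f (f' t) (Ici 0) t)
    (hf' : ∀ t, 0 ≤ t → f' t ≤ -(c * ‖g t‖ ^ 2)) (hm : ∀ t, 0 ≤ t → m ≤ f t)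
    (hg : ∀ s t, 0 ≤ s → 0 ≤ t → dist (g s) (g t) ≤ L * dist s t) :
    Tendsto g atTop (𝓝 0) := by
  have hanti : AntitoneOn f (Ici 0) := antitoneOn_of_hasDerivWithinAt_Ici hf fun t ht =>
    (hf' t ht).trans (neg_nonpos.2 (by positivity))
  have hbdd : BddBelow (f '' Ici 0) := ⟨m, by rintro _ ⟨t, ht, rfl⟩; exact hm t ht⟩
  rw [Metric.tendsto_atTop]
  intro ε hε
  set δ := ε / (2 * (|L| + 1)) with hδ
  have hδ0 : 0 < δ := by positivity
  have hLδ : |L| * δ ≤ ε / 2 := by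
    have : (|L| + 1) * δ = ε / 2 := by rw [hδ]; field_simp
    nlinarith
  set η := c * (ε / 2) ^ 2 * δ with hη
  have hη0 : 0 < η := by positivity
  obtain ⟨_, ⟨T, hT, rfl⟩, hTlt⟩ := exists_lt_of_csInf_lt ((nonempty_Ici (a := (0 : ℝ))).image f)
    (lt_add_of_pos_right (sInf (f '' Ici 0)) hη0)
  refine ⟨T, fun t ht => ?_⟩
  have ht0 : 0 ≤ t := le_trans hT ht
  rw [dist_zero_right]
  by_contra! hge
  obtain ⟨r, hr, hslope⟩ :=
    exists_deriv_eq_slope_of_hasDerivWithinAt_Ici hf ht0 (lt_add_of_pos_right t hδ0)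
  have hr0 : 0 ≤ r := ht0.trans hr.1.le
  have hgr : ε / 2 ≤ ‖g r‖ := by
    have h1 : dist (g t) (g r) ≤ |L| * δ := by
      refine (hg t r ht0 hr0).trans ?_
      rw [Real.dist_eq, abs_sub_comm, abs_of_pos (sub_pos.2 hr.1)]
      have : r - t ≤ δ := by linarith [hr.2]
      have h0 : 0 ≤ r - t := by linarith [hr.1]
      exact mul_le_mul (le_abs_self L) this h0 (abs_nonneg L)
    rw [dist_eq_norm] at h1
    have := norm_sub_norm_le (g t) (g r)
    linarith
  have h2 : c * (ε / 2) ^ 2 ≤ c * ‖g r‖ ^ 2 := by gcongr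
  have h3 : f (t + δ) - f t ≤ -η := by
    have h4 := hf' r hr0
    rw [hslope, add_sub_cancel_left, div_le_iff₀ hδ0] at h4
    have := mul_le_mul_of_nonneg_right h2 hδ0.le
    linarith
  have h5 : sInf (f '' Ici 0) ≤ f (t + δ) :=
    csInf_le hbdd ⟨t + δ, add_nonneg ht0 hδ0.le, rfl⟩
  have h6 : f t ≤ f T := hanti hT ht0 ht
  linarith

/-- If a bounded curve has a derivative which varies more and more slowly, the derivative vanishes
asymptotically. -/
lemma tendsto_zero_of_bounded_primitive {F : Type*} [NormedAddCommGroup F] [NormedSpace ℝ F]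
    {f g g' : ℝ → F} {M : ℝ}
    (hf : ∀ t, 0 ≤ t → HasDerivWithinAt f (g t) (Ici 0) t)
    (hg : ∀ t, 0 ≤ t → HasDerivWithinAt g (g' t) (Ici 0) t)
    (hM : ∀ t, 0 ≤ t → ‖f t‖ ≤ M) (hg' : Tendsto g' atTop (𝓝 0)) :
    Tendsto g atTop (𝓝 0) := by
  have hM0 : 0 ≤ M := (norm_nonneg _).trans (hM 0 le_rfl)
  rw [Metric.tendsto_atTop] at hg' ⊢
  intro ε hε
  -- On a late window of length `τ` the derivative `g` moves by at most `ε / 4`. If `‖g t‖ ≥ ε`,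
  -- then `f` would travel at least `3τε / 4 > 2M`.
  set τ := 4 * M / ε + 1 with hτ
  have hτ0 : 0 < τ := by positivity
  have hτε : τ * ε = 4 * M + ε := by rw [hτ]; field_simp
  obtain ⟨T, hT⟩ := hg' (ε / (4 * τ)) (by positivity)
  refine ⟨max T 0, fun t ht => ?_⟩
  have ht0 : 0 ≤ t := le_trans (le_max_right _ _) ht
  have htT : T ≤ t := le_trans (le_max_left _ _) ht
  have hsub : Icc t (t + τ) ⊆ Ici 0 := fun s hs => ht0.trans hs.1
  have hgs : ∀ s ∈ Icc t (t + τ), ‖g s - g t‖ ≤ ε / 4 := by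
    intro s hs
    have h := Convex.norm_image_sub_le_of_norm_hasDerivWithin_le (s := Icc t (t + τ)) (f := g)
      (f' := g') (C := ε / (4 * τ)) (fun r hr => (hg r (hsub hr)).mono hsub)
      (fun r hr => by
        have := hT r (htT.trans hr.1)
        rw [dist_zero_right] at this
        exact this.le) (convex_Icc _ _) (left_mem_Icc.2 (by linarith)) hs
    refine h.trans ?_
    have h2 : ‖s - t‖ ≤ τ := by
      rw [Real.norm_eq_abs, abs_of_nonneg (sub_nonneg.2 hs.1)]
      linarith [hs.2]
    calc ε / (4 * τ) * ‖s - t‖ ≤ ε / (4 * τ) * τ := by gcongr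
      _ = ε / 4 := by field_simp
  have hfs := Convex.norm_image_sub_le_of_norm_hasDerivWithin_le (s := Icc t (t + τ))
    (f := fun s => f s - s • g t) (f' := fun s => g s - g t) (C := ε / 4)
    (fun r hr => by
      have h := ((hf r (hsub hr)).mono hsub).sub
        ((hasDerivWithinAt_id r (Icc t (t + τ))).smul_const (g t))
      rw [one_smul] at h
      exact h) hgs (convex_Icc _ _) (left_mem_Icc.2 (by linarith))
    (right_mem_Icc.2 (by linarith))
  have h1 : (f (t + τ) - (t + τ) • g t) - (f t - t • g t) = f (t + τ) - f t - τ • g t := by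
    rw [add_smul]; abel
  simp only [h1, add_sub_cancel_left] at hfs
  rw [Real.norm_eq_abs, abs_of_pos hτ0] at hfs
  have h2 : ‖τ • g t‖ ≤ ‖f (t + τ)‖ + ‖f t‖ + ‖f (t + τ) - f t - τ • g t‖ := by
    have e : τ • g t = (f (t + τ) - f t) - (f (t + τ) - f t - τ • g t) := by abel
    calc ‖τ • g t‖ = ‖(f (t + τ) - f t) - (f (t + τ) - f t - τ • g t)‖ := by rw [← e]
      _ ≤ ‖f (t + τ) - f t‖ + ‖f (t + τ) - f t - τ • g t‖ := norm_sub_le _ _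
      _ ≤ _ := by gcongr; exact norm_sub_le _ _
  rw [norm_smul, Real.norm_eq_abs, abs_of_pos hτ0] at h2
  have h3 := hM (t + τ) (by linarith)
  have h4 := hM t ht0
  rw [dist_zero_right]
  by_contra! hge
  have h5 : τ * ε ≤ τ * ‖g t‖ := by gcongr
  linarith

/-- On the part of `K` at distance at least `ε` from `S`, `‖f‖` has a positive minimum, so the curve
eventually avoids that part. -/
lemma convergesToSet_of_isCompact {X Y : Type*} [PseudoMetricSpace X] [NormedAddCommGroup Y]
    {p : ℝ → X} {K : Set X} (hK : IsCompact K) (hp : ∀ᶠ t in atTop, p t ∈ K) {f : X → Y}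
    (hf : Continuous f) (hfp : Tendsto (fun t => f (p t)) atTop (𝓝 0)) {S : Set X}
    (hS : ∀ x, f x = 0 → x ∈ S) : ConvergesToSet p S := by
  intro ε hε
  set D : Set X := ⋂ q ∈ S, {x | ε ≤ dist x q} with hD
  have hDc : IsClosed D := isClosed_biInter fun q _ =>
    isClosed_le continuous_const (continuous_id.dist continuous_const)
  have hKD : IsCompact (K ∩ D) := hK.inter_right hDc
  have hout : ∀ᶠ t in atTop, p t ∉ K ∩ D := by
    rcases (K ∩ D).eq_empty_or_nonempty with h | h
    · simp [h]
    obtain ⟨x₀, hx₀, hmin⟩ := hKD.exists_isMinOn h hf.norm.continuousOn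
    have hpos : 0 < ‖f x₀‖ := by
      refine norm_pos_iff.2 fun h0 => ?_
      have : ε ≤ dist x₀ x₀ := mem_iInter₂.1 hx₀.2 x₀ (hS x₀ h0)
      rw [dist_self] at this
      exact this.not_gt hε
    filter_upwards [(Metric.tendsto_nhds.1 hfp) _ hpos] with t ht hmem
    rw [dist_zero_right] at ht
    exact (isMinOn_iff.1 hmin _ hmem).not_gt ht
  filter_upwards [hp, hout] with t h1 h2
  by_contra! hcon
  exact h2 ⟨h1, mem_iInter₂.2 hcon⟩

end Asymptotics

/-! ### Global solutions of differential equations. -/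

section GlobalExistence

variable {X : Type*} [NormedAddCommGroup X] [NormedSpace ℝ X] [CompleteSpace X]

lemma exists_global_solution {F : ℝ → X → X}
    (hc : ∀ x, ContinuousOn (F · x) (Ici 0))
    (hl : ∀ N : ℕ, ∃ K : ℝ≥0, ∀ t ∈ Icc (0 : ℝ) N, LipschitzWith K (F t))
    (hb : ∀ N : ℕ, ∃ L : ℝ≥0, ∀ t ∈ Icc (0 : ℝ) N, ∀ x, ‖F t x‖ ≤ L) (x₀ : X) :
    ∃ α : ℝ → X, α 0 = x₀ ∧ ∀ t, 0 ≤ t → HasDerivWithinAt α (F t (α t)) (Ici 0) t := by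
  have hsol : ∀ N : ℕ, ∃ α : ℝ → X, α 0 = x₀ ∧
      ∀ t ∈ Icc (0 : ℝ) N, HasDerivWithinAt α (F t (α t)) (Icc 0 N) t := by
    intro N
    obtain ⟨K, hK⟩ := hl N
    obtain ⟨L, hL⟩ := hb N
    -- A field bounded by `L` cannot leave the ball of radius `L * N` in time `N`, so
    -- Picard–Lindelöf covers all of `[0, N]`.
    have hPL : IsPicardLindelof F (tmin := 0) (tmax := N) ⟨0, left_mem_Icc.2 N.cast_nonneg⟩ x₀
        (L * N) 0 L K :=
      { lipschitzOnWith := fun t ht => (hK t ht).lipschitzOnWith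
        continuousOn := fun x _ => (hc x).mono fun t ht => ht.1
        norm_le := fun t ht x _ => hL t ht x
        mul_max_le := by simp }
    exact hPL.exists_eq_forall_mem_Icc_hasDerivWithinAt₀
  choose α hα0 hα using hsol
  have hright : ∀ (N : ℕ) (t : ℝ), t ∈ Ico (0 : ℝ) N →
      HasDerivWithinAt (α N) (F t (α N t)) (Ici t) t := fun N t ht =>
    (hα N t ⟨ht.1, ht.2.le⟩).mono_of_mem_nhdsWithin
      (mem_of_superset (Icc_mem_nhdsGE ht.2) (Icc_subset_Icc_left ht.1))
  have heq : ∀ M N : ℕ, M ≤ N → EqOn (α M) (α N) (Icc 0 M) := by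
    intro M N hMN
    have hMN' : (M : ℝ) ≤ N := by exact_mod_cast hMN
    obtain ⟨K, hK⟩ := hl M
    refine ODE_solution_unique_of_mem_Icc_right (v := F) (s := fun _ => univ) (K := K)
      (fun t ht => (hK t ⟨ht.1, ht.2.le⟩).lipschitzOnWith)
      (fun t ht => (hα M t ht).continuousWithinAt) (fun t ht => hright M t ht)
      (fun _ _ => trivial)
      (fun t ht => ((hα N t ⟨ht.1, ht.2.trans hMN'⟩).continuousWithinAt).mono
        (Icc_subset_Icc_right hMN'))
      (fun t ht => hright N t ⟨ht.1, ht.2.trans_le hMN'⟩) (fun _ _ => trivial) ?_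
    rw [hα0, hα0]
  have hglue : ∀ (N : ℕ) (t : ℝ), t ∈ Icc (0 : ℝ) N → α (⌊t⌋₊ + 1) t = α N t := by
    intro N t ht
    have h1 : t ≤ ((⌊t⌋₊ + 1 : ℕ) : ℝ) := by
      rw [Nat.cast_add, Nat.cast_one]; exact (Nat.lt_floor_add_one t).le
    rcases le_total (⌊t⌋₊ + 1) N with h | h
    · exact heq _ _ h ⟨ht.1, h1⟩
    · exact (heq _ _ h ht).symm
  -- The `+ 1` keeps `t` strictly below the right end of the interval of its local solution.
  refine ⟨fun t => α (⌊t⌋₊ + 1) t, hα0 _, fun t ht => ?_⟩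
  have hN : t < ((⌊t⌋₊ + 1 : ℕ) : ℝ) := by
    rw [Nat.cast_add, Nat.cast_one]; exact Nat.lt_floor_add_one t
  have hmem : Icc (0 : ℝ) ((⌊t⌋₊ + 1 : ℕ) : ℝ) ∈ 𝓝[Ici 0] t := by
    rw [← Ici_inter_Iic]
    exact inter_mem self_mem_nhdsWithin (mem_nhdsWithin_of_mem_nhds (Iic_mem_nhds hN))
  exact ((hα _ t ⟨ht, hN.le⟩).mono_of_mem_nhdsWithin hmem).congr_of_eventuallyEq
    (eventually_of_mem hmem fun s hs => hglue _ s hs) rfl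

end GlobalExistence

/-! ### Gradient and Hessian in coordinates. -/

section Gradient

variable {V : Type*} [Fintype V] [DecidableEq V] {H : (V → ℝ) → ℝ}
open Matrix

lemma fderiv_eq_gradVec_dotProduct (x v : V → ℝ) : fderiv ℝ H x v = gradVec H x ⬝ᵥ v := by
  conv_lhs => rw [pi_eq_sum_univ' v]
  rw [map_sum]
  simp [gradVec, dotProduct, mul_comm]

lemma contDiff_gradVec (hH : ContDiff ℝ 2 H) : ContDiff ℝ 1 (gradVec H) :=
  contDiff_pi.2 fun _ => (hH.fderiv_right (m := 1) (by norm_num)).clm_apply contDiff_const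

lemma fderiv_gradVec_apply (hH : ContDiff ℝ 2 H) (x v : V → ℝ) :
    fderiv ℝ (gradVec H) x v = hessianMatrix H x *ᵥ v := by
  have hd := (contDiff_gradVec hH).differentiable one_ne_zero x
  ext i
  have h1 : fderiv ℝ (gradVec H) x v i = fderiv ℝ (fun y => gradVec H y i) x v := by
    rw [fderiv_apply hd]; rfl
  rw [h1, fderiv_eq_gradVec_dotProduct]
  rfl

end Gradient

/-! ### Existence of trajectories. -/

namespace FlowGraph

open Matrix

variable {V E : Type*} [Fintype V] [DecidableEq V] [Fintype E]

/-- The gradient is only locally Lipschitz, but saturation bounds `x'` by some `C`. Started at `0`,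
a solution satisfies `‖x t‖ ≤ C * t`, so clipping `x` to that box makes the field Lipschitz on
bounded time intervals and is inactive along the solution. -/
theorem exists_isTrajectory (G : FlowGraph V E) {H : (V → ℝ) → ℝ} (hH : ContDiff ℝ 2 H)
    {um up : E → ℝ} (hlt : ∀ e, um e < up e) : ∃ x xc, G.IsTrajectory H um up x xc := by
  set A : (E → ℝ) →L[ℝ] (V → ℝ) := LinearMap.toContinuousLinearMap G.incidence.mulVecLin
  set A' : (V → ℝ) →L[ℝ] (E → ℝ) := LinearMap.toContinuousLinearMap G.incidenceᵀ.mulVecLin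
  set φ : (V → ℝ) → (E → ℝ) := fun x => A' (gradVec H x) with hφdef
  have hφ : ContDiff ℝ 1 φ := A'.contDiff.comp (contDiff_gradVec hH)
  obtain ⟨C, hC0, hC⟩ : ∃ C, 0 ≤ C ∧ ∀ z, ‖A (sat z um up)‖ ≤ C := by
    obtain ⟨C, hC⟩ := (isCompact_Icc (a := um) (b := up)).exists_bound_of_continuousOn
      A.continuous.continuousOn
    exact ⟨max C 0, le_max_right _ _, fun z => le_max_of_le_left
      (hC _ ⟨fun e => (sat_mem_Icc hlt z e).1, fun e => (sat_mem_Icc hlt z e).2⟩)⟩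
  set clip : ℝ → (V → ℝ) → V → ℝ := fun t x i => max (-(C * t)) (min (x i) (C * t)) with hclip
  have hclip_lip : ∀ t, LipschitzWith 1 (clip t) := fun t => by
    refine LipschitzWith.of_dist_le_mul fun z w => ?_
    rw [NNReal.coe_one, one_mul]
    refine (dist_pi_le_iff dist_nonneg).2 fun e => ?_
    simp only [hclip, Real.dist_eq]
    refine (abs_max_sub_max_le_max _ _ _ _).trans ?_
    rw [sub_self, abs_zero, max_eq_right (abs_nonneg _)]
    refine (abs_min_sub_min_le_max _ _ _ _).trans ?_
    rw [sub_self, abs_zero, max_eq_left (abs_nonneg _), ← Real.dist_eq]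
    exact dist_le_pi_dist z w e
  set box : ℕ → Set (V → ℝ) := fun N => Icc (fun _ => -(C * N)) (fun _ => C * N)
  have hclip_mem : ∀ N : ℕ, ∀ t ∈ Icc (0 : ℝ) N, ∀ x, clip t x ∈ box N := by
    intro N t ht x
    have h1 : C * t ≤ C * N := by gcongr; exact ht.2
    have h2 : 0 ≤ C * t := mul_nonneg hC0 ht.1
    exact ⟨fun i => le_max_of_le_left (neg_le_neg h1),
      fun i => max_le (by linarith) (min_le_of_right_le h1)⟩
  set F : ℝ → (V → ℝ) × (E → ℝ) → (V → ℝ) × (E → ℝ) := fun t p =>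
    (A (sat (-(φ (clip t p.1)) - p.2) um up), φ (clip t p.1)) with hF
  obtain ⟨α, hα0, hα⟩ := exists_global_solution (F := F) (x₀ := 0)
    (fun p => by
      have h1 : Continuous fun t => clip t p.1 := by
        refine continuous_pi fun i => ?_
        simp only [hclip]
        fun_prop
      have h2 : Continuous fun t => φ (clip t p.1) := hφ.continuous.comp h1
      exact ((A.continuous.comp ((lipschitzWith_sat hlt).continuous.comp
        (h2.neg.sub continuous_const))).prodMk h2).continuousOn)
    (fun N => by
      obtain ⟨K, hK⟩ := (hφ.contDiffOn (s := box N)).exists_lipschitzOnWith one_ne_zero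
        (convex_Icc _ _) isCompact_Icc
      have h : ∀ t ∈ Icc (0 : ℝ) N,
          LipschitzWith K fun p : (V → ℝ) × (E → ℝ) => φ (clip t p.1) := fun t ht => by
        have h1 : LipschitzWith (K * 1) fun x => φ (clip t x) := by
          rw [← lipschitzOnWith_univ]
          exact hK.comp (hclip_lip t).lipschitzOnWith fun x _ => hclip_mem N t ht x
        have := h1.comp (LipschitzWith.prod_fst (α := V → ℝ) (β := E → ℝ))
        rwa [mul_one, mul_one] at this
      exact ⟨_, fun t ht => (A.lipschitz.comp ((lipschitzWith_sat hlt).comp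
        ((h t ht).neg.sub LipschitzWith.prod_snd))).prodMk (h t ht)⟩)
    (fun N => by
      obtain ⟨L, hL⟩ := (isCompact_Icc : IsCompact (box N)).exists_bound_of_continuousOn
        hφ.continuous.continuousOn
      refine ⟨(max C L).toNNReal, fun t ht p => ?_⟩
      rw [Real.coe_toNNReal _ (le_max_of_le_left hC0)]
      exact max_le_max (hC _) (hL _ (hclip_mem N t ht p.1)))
  have hx : ∀ t, 0 ≤ t → HasDerivWithinAt (fun s => (α s).1) (F t (α t)).1 (Ici 0) t :=
    fun t ht => (ContinuousLinearMap.fst ℝ (V → ℝ) (E → ℝ)).hasFDerivAt.comp_hasDerivWithinAt t (hα t ht)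
  have hxc : ∀ t, 0 ≤ t → HasDerivWithinAt (fun s => (α s).2) (F t (α t)).2 (Ici 0) t :=
    fun t ht => (ContinuousLinearMap.snd ℝ (V → ℝ) (E → ℝ)).hasFDerivAt.comp_hasDerivWithinAt t (hα t ht)
  have hclip_eq : ∀ t, 0 ≤ t → clip t (α t).1 = (α t).1 := by
    intro t ht
    have h := dist_le_of_hasDerivWithinAt_Ici hx (fun s _ => hC _) ht le_rfl
    rw [hα0, Prod.fst_zero, dist_zero_right, dist_zero_right, Real.norm_of_nonneg ht] at h
    ext i
    have h1 := abs_le.1 ((norm_le_pi_norm (α t).1 i).trans h)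
    simp only [hclip]
    rw [min_eq_left h1.2, max_eq_right h1.1]
  refine ⟨fun t => (α t).1, fun t => (α t).2, fun t ht => ?_⟩
  have h1 := hx t ht
  have h2 := hxc t ht
  simp only [hF, hclip_eq t ht] at h1 h2
  exact ⟨h1, h2⟩

end FlowGraph

lemma exists_isCompact_sublevel {X : Type*} [TopologicalSpace X] {H : X → ℝ}
    (hrad : Tendsto H (cocompact X) atTop) (M : ℝ) : ∃ K : Set X, IsCompact K ∧ ∀ x, H x ≤ M → x ∈ K := by
  obtain ⟨K, hK, hsub⟩ := mem_cocompact.1 (hrad.eventually_gt_atTop M)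
  exact ⟨K, hK, fun x hx => by_contra fun h => (hsub h : M < H x).not_ge hx⟩

/-! ### Consequences of the positive definite Hessian. -/

section Gradient

variable {V : Type*} [Fintype V] [DecidableEq V] {H : (V → ℝ) → ℝ}
open Matrix

/-- The Hessian form has a positive minimum over `K` times the unit sphere; homogeneity does the
rest. -/
lemma exists_mul_sq_norm_le_hessianMatrix (hH : ContDiff ℝ 2 H)
    (hHess : ∀ x, (hessianMatrix H x).PosDef) {K : Set (V → ℝ)} (hK : IsCompact K) :
    ∃ c > 0, ∀ x ∈ K, ∀ v, c * ‖v‖ ^ 2 ≤ (hessianMatrix H x *ᵥ v) ⬝ᵥ v := by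
  set Q : (V → ℝ) × (V → ℝ) → ℝ := fun q => fderiv ℝ (gradVec H) q.1 q.2 ⬝ᵥ q.2 with hQ
  have hcont : Continuous Q := by
    have h1 : Continuous fun q : (V → ℝ) × (V → ℝ) => fderiv ℝ (gradVec H) q.1 q.2 :=
      (((contDiff_gradVec hH).continuous_fderiv one_ne_zero).comp continuous_fst).clm_apply
        continuous_snd
    exact h1.dotProduct continuous_snd
  have hpos : ∀ x v, v ≠ 0 → 0 < Q (x, v) := by
    intro x v hv
    have := (hHess x).dotProduct_mulVec_pos hv
    simp only [hQ, fderiv_gradVec_apply hH]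
    rwa [star_trivial, dotProduct_comm] at this
  have hsph : IsCompact (K ×ˢ Metric.sphere (0 : V → ℝ) 1) := hK.prod (isCompact_sphere 0 1)
  obtain ⟨c, hc0, hc⟩ : ∃ c > 0, ∀ q ∈ K ×ˢ Metric.sphere (0 : V → ℝ) 1, c ≤ Q q := by
    rcases (K ×ˢ Metric.sphere (0 : V → ℝ) 1).eq_empty_or_nonempty with h | h
    · exact ⟨1, one_pos, by simp [h]⟩
    · obtain ⟨q, hq, hmin⟩ := hsph.exists_isMinOn h hcont.continuousOn
      have hq2 : q.2 ≠ 0 := ne_zero_of_mem_unit_sphere (⟨q.2, hq.2⟩ : Metric.sphere (0 : V → ℝ) 1)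
      exact ⟨Q q, hpos q.1 q.2 hq2, fun r hr => isMinOn_iff.1 hmin r hr⟩
  refine ⟨c, hc0, fun x hx v => ?_⟩
  rcases eq_or_ne v 0 with rfl | hv
  · simp
  have hv0 : 0 < ‖v‖ := norm_pos_iff.2 hv
  have h := hc (x, ‖v‖⁻¹ • v) ⟨hx, by simp [norm_smul, hv0.ne']⟩
  simp only [hQ, map_smul, smul_dotProduct, dotProduct_smul, smul_eq_mul] at h
  rw [fderiv_gradVec_apply hH] at h
  calc c * ‖v‖ ^ 2 ≤ (‖v‖⁻¹ * (‖v‖⁻¹ * ((hessianMatrix H x *ᵥ v) ⬝ᵥ v))) * ‖v‖ ^ 2 := by gcongr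
    _ = (hessianMatrix H x *ᵥ v) ⬝ᵥ v := by field_simp

/-- At a global minimiser the gradient vanishes and its derivative, the Hessian, is invertible, so
the gradient map is locally onto there. -/
lemma eventually_exists_gradVec_eq (hH : ContDiff ℝ 2 H)
    (hHess : ∀ x, (hessianMatrix H x).PosDef) (hrad : Tendsto H (cocompact (V → ℝ)) atTop) :
    ∀ᶠ g in 𝓝 (0 : V → ℝ), ∃ x, gradVec H x = g := by
  obtain ⟨x₀, hx₀⟩ := hH.continuous.exists_forall_le hrad
  have h0 : gradVec H x₀ = 0 := by
    have : fderiv ℝ H x₀ = 0 := IsLocalMin.fderiv_eq_zero (Eventually.of_forall hx₀)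
    ext i
    simp [gradVec, this]
  have hinj : Function.Injective (fderiv ℝ (gradVec H) x₀ : (V → ℝ) →ₗ[ℝ] (V → ℝ)) := by
    refine (injective_iff_map_eq_zero _).2 fun v hv => ?_
    by_contra hne
    have := (hHess x₀).dotProduct_mulVec_pos hne
    rw [ContinuousLinearMap.coe_coe, fderiv_gradVec_apply hH] at hv
    simp [hv] at this
  have hmap := ((contDiff_gradVec hH).contDiffAt.hasStrictFDerivAt one_ne_zero).map_nhds_eq_of_surj
    (a := x₀) (LinearMap.range_eq_top.2 (LinearMap.injective_iff_surjective.1 hinj))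
  rw [h0] at hmap
  rw [← hmap]
  exact range_mem_map

lemma exists_gradVec_eq_smul (hH : ContDiff ℝ 2 H)
    (hHess : ∀ x, (hessianMatrix H x).PosDef) (hrad : Tendsto H (cocompact (V → ℝ)) atTop)
    (p : V → ℝ) : ∃ ε > 0, ∃ x, gradVec H x = (ε : ℝ) • p := by
  have hlim : Tendsto (fun ε : ℝ => ε • p) (𝓝[>] 0) (𝓝 0) := by
    have : Tendsto (fun ε : ℝ => ε • p) (𝓝 0) (𝓝 ((0 : ℝ) • p)) :=
      (continuous_id.smul continuous_const).tendsto 0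
    rw [zero_smul] at this
    exact this.mono_left nhdsWithin_le_nhds
  obtain ⟨ε, hε, h⟩ := ((hlim.eventually (eventually_exists_gradVec_eq hH hHess hrad)).and
    self_mem_nhdsWithin).exists
  exact ⟨ε, h, hε⟩

end Gradient

/-! ### The Lyapunov function and sufficiency. -/

namespace FlowGraph

open Matrix

variable {V E : Type*} [Fintype V] [DecidableEq V] [Fintype E] {G : FlowGraph V E}
  {H : (V → ℝ) → ℝ} {um up : E → ℝ}

/-- The unsaturated controller output. -/
def output (G : FlowGraph V E) (H : (V → ℝ) → ℝ) (x : V → ℝ) (xc : E → ℝ) : E → ℝ :=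
  -(G.incidenceᵀ *ᵥ gradVec H x) - xc

/-- The energy of the plant plus the storage of the controller, shifted by a circulation `c`. -/
def storage (G : FlowGraph V E) (H : (V → ℝ) → ℝ) (um up : E → ℝ) (c : ℝ) (x : V → ℝ)
    (xc : E → ℝ) : ℝ :=
  H x + ∑ e, (satPrimitive (um e) (up e) (G.output H x xc e) - c * G.output H x xc e)

lemma IsTrajectory.hasDerivWithinAt_transpose_incidence_mulVec {x : ℝ → V → ℝ} {xc : ℝ → E → ℝ}
    (h : G.IsTrajectory H um up x xc) (hH : ContDiff ℝ 2 H) {t : ℝ} (ht : 0 ≤ t) :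
    HasDerivWithinAt (fun s => G.incidenceᵀ *ᵥ gradVec H (x s))
      (G.incidenceᵀ *ᵥ (hessianMatrix H (x t) *ᵥ
        (G.incidence *ᵥ sat (G.output H (x t) (xc t)) um up))) (Ici 0) t := by
  set A' : (V → ℝ) →L[ℝ] (E → ℝ) := LinearMap.toContinuousLinearMap G.incidenceᵀ.mulVecLin
  rw [← fderiv_gradVec_apply hH]
  exact A'.hasFDerivAt.comp_hasDerivWithinAt t (((contDiff_gradVec hH).differentiable one_ne_zero
    (x t)).hasFDerivAt.comp_hasDerivWithinAt t (h t ht).1)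

/-- With `w = x'`, the plant contributes `∇H ⬝ w` and the controller `(sat z - c) ⬝ z'`, where `z' =
-Bᵀ(Hess w + ∇H)`. Moving `Bᵀ` across and using `B c = 0` cancels the supply rate `∇H ⬝ w`. -/
lemma IsTrajectory.hasDerivWithinAt_storage {x : ℝ → V → ℝ} {xc : ℝ → E → ℝ}
    (h : G.IsTrajectory H um up x xc) (hH : ContDiff ℝ 2 H) (hlt : ∀ e, um e < up e) {c : ℝ}
    (hc : G.incidence *ᵥ (fun _ => c) = 0) {t : ℝ} (ht : 0 ≤ t) :
    HasDerivWithinAt (fun s => G.storage H um up c (x s) (xc s))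
      (-((hessianMatrix H (x t) *ᵥ
          (G.incidence *ᵥ sat (G.output H (x t) (xc t)) um up)) ⬝ᵥ
        (G.incidence *ᵥ sat (G.output H (x t) (xc t)) um up))) (Ici 0) t := by
  have hy := h.hasDerivWithinAt_transpose_incidence_mulVec hH ht
  obtain ⟨hx, hxc⟩ := h t ht
  set z : ℝ → E → ℝ := fun s => G.output H (x s) (xc s) with hz
  set w := G.incidence *ᵥ sat (z t) um up with hw
  have hzd : HasDerivWithinAt z (-(G.incidenceᵀ *ᵥ (hessianMatrix H (x t) *ᵥ w)) -
      G.incidenceᵀ *ᵥ gradVec H (x t)) (Ici 0) t := hy.neg.sub hxc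
  have hHd : HasDerivWithinAt (fun s => H (x s)) (gradVec H (x t) ⬝ᵥ w) (Ici 0) t := by
    rw [← fderiv_eq_gradVec_dotProduct]
    exact (hH.differentiable two_ne_zero (x t)).hasFDerivAt.comp_hasDerivWithinAt t hx
  have hsum := HasDerivWithinAt.fun_sum (u := Finset.univ) fun e (_ : e ∈ Finset.univ) =>
    ((hasDerivAt_satPrimitive (um e) (up e) (z t e)).comp_hasDerivWithinAt t
      (hasDerivWithinAt_pi.1 hzd e)).sub ((hasDerivWithinAt_pi.1 hzd e).const_mul c)
  refine (hHd.add hsum).congr_deriv ?_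
  have h1 : ∀ e, max (um e) (min (z t e) (up e)) = sat (z t) um up e := fun e =>
    (sat_apply (hlt e) _).symm
  simp only [h1, ← sub_mul]
  change _ + (sat (z t) um up - fun _ => c) ⬝ᵥ _ = _
  rw [dotProduct_comm (_ - _), ← neg_add', neg_dotProduct, ← mulVec_add,
    ← dotProduct_incidence_mulVec, mulVec_sub, hc, sub_zero, ← hw, add_dotProduct]
  ring

/-- The storage function is bounded from below, and its sublevel sets are bounded. -/
lemma exists_isCompact_storage_sublevel (hH : Continuous H)
    (hrad : Tendsto H (cocompact (V → ℝ)) atTop) {c : ℝ} (hcI : ∀ e, c ∈ Ioo (um e) (up e))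
    (G : FlowGraph V E) (M : ℝ) :
    (∃ m, ∀ x xc, m ≤ G.storage H um up c x xc) ∧
    ∃ Kx : Set (V → ℝ), ∃ Kz : Set (E → ℝ), IsCompact Kx ∧ IsCompact Kz ∧
      ∀ x xc, G.storage H um up c x xc ≤ M → x ∈ Kx ∧ G.output H x xc ∈ Kz := by
  obtain ⟨x₀, hx₀⟩ := hH.exists_forall_le hrad
  choose δ hδ K hK using fun e => exists_satPrimitive_lower_bound (hcI e)
  have hlow : ∀ x xc, H x + ∑ e, (δ e * |G.output H x xc e|) - ∑ e, K e ≤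
      G.storage H um up c x xc := fun x xc => by
    have : ∑ e, (δ e * |G.output H x xc e| - K e) ≤ ∑ e, (satPrimitive (um e) (up e)
        (G.output H x xc e) - c * G.output H x xc e) := Finset.sum_le_sum fun e _ => hK e _
    rw [Finset.sum_sub_distrib] at this
    rw [storage]
    linarith
  have hδz : ∀ (z : E → ℝ) e, 0 ≤ δ e * |z e| := fun z e => mul_nonneg (hδ e).le (abs_nonneg _)
  have hsum0 : ∀ z : E → ℝ, 0 ≤ ∑ e, (δ e * |z e|) := fun z =>
    Finset.sum_nonneg fun e _ => hδz z e
  obtain ⟨Kx, hKx, hKx'⟩ := exists_isCompact_sublevel hrad (M + ∑ e, K e)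
  set D := M - H x₀ + ∑ e, K e with hD
  refine ⟨⟨H x₀ - ∑ e, K e, fun x xc => ?_⟩, Kx, Icc (fun e => -(D / δ e)) (fun e => D / δ e),
    hKx, isCompact_Icc, fun x xc h => ⟨hKx' _ ?_, ?_⟩⟩
  · linarith [hlow x xc, hsum0 (G.output H x xc), hx₀ x]
  · linarith [hlow x xc, hsum0 (G.output H x xc)]
  · have : ∀ e, |G.output H x xc e| ≤ D / δ e := fun e => by
      rw [le_div_iff₀' (hδ e)]
      have := Finset.single_le_sum (fun e _ => hδz (G.output H x xc) e) (Finset.mem_univ e)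
      linarith [hlow x xc, hx₀ x]
    exact ⟨fun e => (abs_le.1 (this e)).1, fun e => (abs_le.1 (this e)).2⟩

theorem IsTrajectory.convergesToSet {x : ℝ → V → ℝ} {xc : ℝ → E → ℝ}
    (h : G.IsTrajectory H um up x xc) [Nonempty V] (hs : G.StronglyConnected)
    (hH : ContDiff ℝ 2 H) (hHess : ∀ x, (hessianMatrix H x).PosDef)
    (hrad : Tendsto H (cocompact (V → ℝ)) atTop) {c : ℝ} (hcI : ∀ e, c ∈ Ioo (um e) (up e))
    (hc : G.incidence *ᵥ (fun _ => c) = 0) :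
    ConvergesToSet (fun t => (x t, xc t)) (G.loadBalancingSet H um up) := by
  have hlt : ∀ e, um e < up e := fun e => (hcI e).1.trans (hcI e).2
  set A : (E → ℝ) →L[ℝ] (V → ℝ) := LinearMap.toContinuousLinearMap G.incidence.mulVecLin
  set A' : (V → ℝ) →L[ℝ] (E → ℝ) := LinearMap.toContinuousLinearMap G.incidenceᵀ.mulVecLin
  have hgc : Continuous (gradVec H) := (contDiff_gradVec hH).continuous
  have hDc : Continuous (fderiv ℝ (gradVec H)) :=
    (contDiff_gradVec hH).continuous_fderiv one_ne_zero
  set ψ : (E → ℝ) → V → ℝ := fun z => A (sat z um up) with hψ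
  have hψL : LipschitzWith (‖A‖₊ * 1) ψ := A.lipschitz.comp (lipschitzWith_sat hlt)
  set y : ℝ → E → ℝ := fun t => A' (gradVec H (x t)) with hy
  set z : ℝ → E → ℝ := fun t => -(y t) - xc t with hz
  set w : ℝ → V → ℝ := fun t => ψ (z t) with hw
  set W : ℝ → ℝ := fun t => G.storage H um up c (x t) (xc t)
  have hWd : ∀ t, 0 ≤ t →
      HasDerivWithinAt W (-((hessianMatrix H (x t) *ᵥ w t) ⬝ᵥ w t)) (Ici 0) t :=
    fun t ht => h.hasDerivWithinAt_storage hH hlt hc ht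
  have hyd : ∀ t, 0 ≤ t →
      HasDerivWithinAt y (A' (fderiv ℝ (gradVec H) (x t) (w t))) (Ici 0) t := fun t ht => by
    rw [fderiv_gradVec_apply hH]
    exact h.hasDerivWithinAt_transpose_incidence_mulVec hH ht
  have hxcd : ∀ t, 0 ≤ t → HasDerivWithinAt xc (y t) (Ici 0) t := fun t ht => (h t ht).2
  have hWanti : AntitoneOn W (Ici 0) := antitoneOn_of_hasDerivWithinAt_Ici hWd fun t _ => by
    have := (hHess (x t)).posSemidef.dotProduct_mulVec_nonneg (w t)
    rw [star_trivial, dotProduct_comm] at this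
    exact neg_nonpos.2 this
  obtain ⟨⟨m, hm⟩, Kx, Kz, hKx, hKz, hK⟩ :=
    exists_isCompact_storage_sublevel hH.continuous hrad hcI G (W 0)
  have hmem : ∀ t, 0 ≤ t → (x t, z t) ∈ Kx ×ˢ Kz := fun t ht =>
    hK _ _ (hWanti self_mem_Ici ht ht)
  have hxK : ∀ t, 0 ≤ t → x t ∈ Kx := fun t ht => (hmem t ht).1
  have hP : IsCompact (Kx ×ˢ Kz) := hKx.prod hKz
  -- The Lyapunov bound confines `(x, z)`; this image confines `(x, xc)`, since `xc = -y - z`.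
  set S := (fun q : (V → ℝ) × (E → ℝ) => (q.1, -(A' (gradVec H q.1)) - q.2)) '' (Kx ×ˢ Kz) with hSdef
  have hS : IsCompact S := hP.image (continuous_fst.prodMk
    (((A'.continuous.comp (hgc.comp continuous_fst)).neg).sub continuous_snd))
  have hpS : ∀ t, 0 ≤ t → (x t, xc t) ∈ S := fun t ht => ⟨_, hmem t ht, by simp [hz, hy]⟩
  -- `z` is Lipschitz in time, hence so is `w`
  obtain ⟨L, hL⟩ := hP.exists_bound_of_continuousOn
    (f := fun q : (V → ℝ) × (E → ℝ) =>
      -(A' (fderiv ℝ (gradVec H) q.1 (ψ q.2))) - A' (gradVec H q.1)) (Continuous.continuousOn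
    ((A'.continuous.comp ((hDc.comp continuous_fst).clm_apply
      (hψL.continuous.comp continuous_snd))).neg.sub
      (A'.continuous.comp (hgc.comp continuous_fst))))
  have hzd : ∀ t, 0 ≤ t → HasDerivWithinAt z
      (-(A' (fderiv ℝ (gradVec H) (x t) (w t))) - y t) (Ici 0) t :=
    fun t ht => (hyd t ht).neg.sub (hxcd t ht)
  have hzL : ∀ t, 0 ≤ t → ‖-(A' (fderiv ℝ (gradVec H) (x t) (w t))) - y t‖ ≤ L :=
    fun t ht => hL (x t, z t) (hmem t ht)
  have hwL : ∀ s t, 0 ≤ s → 0 ≤ t → dist (w s) (w t) ≤ (‖A‖₊ * 1 : ℝ≥0) * L * dist s t := by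
    intro s t hs ht
    have h1 := dist_le_of_hasDerivWithinAt_Ici hzd hzL hs ht
    refine (hψL.dist_le_mul _ _).trans ?_
    rw [mul_assoc]
    gcongr
  obtain ⟨lam, hlam, hquad⟩ := exists_mul_sq_norm_le_hessianMatrix hH hHess hKx
  have hw0 : Tendsto w atTop (𝓝 0) := tendsto_zero_of_dissipation hlam hWd
    (fun t ht => neg_le_neg (hquad _ (hxK t ht) _))
    (fun t _ => hm _ _) hwL
  -- the derivative of `y` tends to zero
  obtain ⟨M, hM⟩ := hKx.exists_bound_of_continuousOn hDc.continuousOn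
  have hyd0 : Tendsto (fun t => A' (fderiv ℝ (gradVec H) (x t) (w t))) atTop (𝓝 0) := by
    refine squeeze_zero_norm' (a := fun t => ‖A'‖ * (M * ‖w t‖)) ?_ ?_
    · filter_upwards [eventually_ge_atTop 0] with t ht
      have h1 := A'.le_opNorm (fderiv ℝ (gradVec H) (x t) (w t))
      have h2 := (fderiv ℝ (gradVec H) (x t)).le_of_opNorm_le (hM _ (hxK t ht)) (w t)
      exact h1.trans (mul_le_mul_of_nonneg_left h2 (norm_nonneg _))
    · simpa using (hw0.norm.const_mul M).const_mul ‖A'‖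
  obtain ⟨R, hR⟩ := hS.exists_bound_of_continuousOn (continuous_snd (X := V → ℝ)).continuousOn
  have hy0 : Tendsto y atTop (𝓝 0) := tendsto_zero_of_bounded_primitive hxcd hyd
    (fun t ht => hR _ (hpS t ht)) hyd0
  -- Since `-xc - z = y → 0` and `ψ` is Lipschitz, `-xc` may replace `z` in the limit.
  have hlast : Tendsto (fun t => ψ (-xc t)) atTop (𝓝 0) := by
    have h1 : Tendsto (fun t => ψ (-xc t) - w t) atTop (𝓝 0) := by
      refine squeeze_zero_norm (a := fun t => (‖A‖₊ * 1 : ℝ≥0) * ‖y t‖) (fun t => ?_)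
        (by simpa using hy0.norm.const_mul _)
      have := hψL.dist_le_mul (-xc t) (z t)
      rw [dist_eq_norm, dist_eq_norm] at this
      have e : -xc t - z t = y t := by simp only [hz]; abel
      rwa [e] at this
    simpa using h1.add hw0
  refine convergesToSet_of_isCompact hS
    ((eventually_ge_atTop 0).mono fun t ht => hpS t ht)
    (f := fun q : (V → ℝ) × (E → ℝ) => (A' (gradVec H q.1), ψ (-q.2)))
    ((A'.continuous.comp (hgc.comp continuous_fst)).prodMk
      (hψL.continuous.comp continuous_snd.neg)) (hy0.prodMk_nhds hlast) fun q hq => ?_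
  obtain ⟨h1, h2⟩ := Prod.ext_iff.1 hq
  obtain ⟨v⟩ := ‹Nonempty V›
  exact ⟨⟨gradVec H q.1 v, funext fun i =>
    hs.eq_of_transpose_incidence_mulVec_eq_zero h1 i v⟩, h2⟩

end FlowGraph

/-! ### Intersections of the constraint intervals. -/

lemma nonempty_interior_iInter_Icc_iff {E : Type*} [Finite E] [Nonempty E] {a b : E → ℝ} :
    (interior (⋂ e, Icc (a e) (b e))).Nonempty ↔ ∀ i j, a i < b j := by
  constructor
  · rintro ⟨c, hc⟩ i j
    have h := mem_iInter.1 (interior_iInter_subset _ hc)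
    simp only [interior_Icc] at h
    exact (h i).1.trans (h j).2
  · intro h
    obtain ⟨i, hi⟩ := Finite.exists_max a
    obtain ⟨j, hj⟩ := Finite.exists_min b
    obtain ⟨c, hc⟩ := exists_between (h i j)
    refine ⟨c, mem_interior.2 ⟨Ioo (a i) (b j), fun s hs => mem_iInter.2 fun e =>
      ⟨(hi e).trans hs.1.le, hs.2.le.trans (hj e)⟩, isOpen_Ioo, hc⟩⟩

lemma exists_forall_mem_Ioo {E : Type*} [Finite E] [Nonempty E] {a b : E → ℝ}
    (h : ∀ i j, a i < b j) : ∃ c, ∀ e, c ∈ Ioo (a e) (b e) := by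
  obtain ⟨i, hi⟩ := Finite.exists_max a
  obtain ⟨j, hj⟩ := Finite.exists_min b
  obtain ⟨c, hc⟩ := exists_between (h i j)
  exact ⟨c, fun e => ⟨(hi e).trans_lt hc.1, hc.2.trans_le (hj e)⟩⟩

lemma ConvergesToSet.nonempty {X : Type*} [PseudoMetricSpace X] {p : ℝ → X} {S : Set X}
    (h : ConvergesToSet p S) : S.Nonempty := by
  obtain ⟨t, q, hq, -⟩ := (h 1 one_pos).exists
  exact ⟨q, hq⟩

/-! ### Necessity, by drifting controllers. -/

namespace FlowGraph

open Matrix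

variable {V E : Type*} [Fintype V] [DecidableEq V] [Fintype E] {G : FlowGraph V E}
  {H : (V → ℝ) → ℝ} {um up : E → ℝ}

/-- A trajectory along which the saturated flow is a constant circulation keeps `x` constant. -/
lemma isTrajectory_of_sat_eq {x : V → ℝ} {xc u : E → ℝ} (hu : G.incidence *ᵥ u = 0)
    (hsat : ∀ t : ℝ, 0 ≤ t → sat (-(G.incidenceᵀ *ᵥ gradVec H x) -
      (xc + t • (G.incidenceᵀ *ᵥ gradVec H x))) um up = u) :
    G.IsTrajectory H um up (fun _ => x) (fun t => xc + t • (G.incidenceᵀ *ᵥ gradVec H x)) := by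
  intro t ht
  constructor
  · rw [hsat t ht, hu]
    exact hasDerivWithinAt_const _ _ _
  · have h := ((hasDerivWithinAt_id t (Ici (0 : ℝ))).smul_const
      (G.incidenceᵀ *ᵥ gradVec H x)).const_add xc
    rwa [one_smul] at h

/-- As `x` does not move, it is a limit of points where `Bᵀ∇H` vanishes, and this is a closed
condition. -/
lemma transpose_incidence_mulVec_gradVec_eq_zero (hH : ContDiff ℝ 2 H) {x : V → ℝ}
    {xc : ℝ → E → ℝ} (h : ConvergesToSet (fun t => (x, xc t)) (G.loadBalancingSet H um up)) :
    G.incidenceᵀ *ᵥ gradVec H x = 0 := by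
  set A' : (V → ℝ) →L[ℝ] (E → ℝ) := LinearMap.toContinuousLinearMap G.incidenceᵀ.mulVecLin
  have hcl : IsClosed {x | A' (gradVec H x) = 0} :=
    isClosed_eq (A'.continuous.comp (contDiff_gradVec hH).continuous) continuous_const
  have : x ∈ closure {x | A' (gradVec H x) = 0} := by
    refine Metric.mem_closure_iff.2 fun ε hε => ?_
    obtain ⟨t, q, ⟨⟨α, hα⟩, -⟩, hq⟩ := (h ε hε).exists
    refine ⟨q.1, ?_, lt_of_le_of_lt (le_max_left _ _) hq⟩
    ext e
    change (G.incidenceᵀ *ᵥ gradVec H q.1) e = 0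
    rw [transpose_incidence_mulVec, hα, sub_self]
  rwa [hcl.closure_eq] at this

/-- If a constant circulation `u` remains admissible while the controller state drifts in the
direction `Bᵀ p`, then convergence of all trajectories forces `Bᵀ p = 0`. -/
lemma transpose_incidence_mulVec_eq_zero_of_drift (hH : ContDiff ℝ 2 H)
    (hHess : ∀ x, (hessianMatrix H x).PosDef) (hrad : Tendsto H (cocompact (V → ℝ)) atTop)
    (hconv : ∀ (x : ℝ → V → ℝ) (xc : ℝ → E → ℝ), G.IsTrajectory H um up x xc →
      ConvergesToSet (fun t => (x t, xc t)) (G.loadBalancingSet H um up))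
    {u : E → ℝ} (hu : G.incidence *ᵥ u = 0) (p : V → ℝ)
    (hsat : ∀ t : ℝ, 0 ≤ t → sat (u - t • (G.incidenceᵀ *ᵥ p)) um up = u) :
    G.incidenceᵀ *ᵥ p = 0 := by
  obtain ⟨ε, hε, x, hx⟩ := exists_gradVec_eq_smul hH hHess hrad p
  -- Starting at `xc = -u`, the integral term shifts the output by `-t ε Bᵀp` and the proportional
  -- term by a further `-ε Bᵀp`, hence the factor `1 + t`.
  have htraj := isTrajectory_of_sat_eq (G := G) (H := H) (um := um) (up := up) (x := x)
    (xc := -u) hu fun t ht => by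
      have e : -(G.incidenceᵀ *ᵥ gradVec H x) - (-u + t • (G.incidenceᵀ *ᵥ gradVec H x)) =
          u - ((1 + t) * ε) • (G.incidenceᵀ *ᵥ p) := by
        rw [hx, mulVec_smul, mul_smul, add_smul, one_smul]
        abel
      rw [e]
      exact hsat _ (by positivity)
  have h0 := transpose_incidence_mulVec_gradVec_eq_zero hH (hconv _ _ htraj)
  rw [hx, mulVec_smul] at h0
  exact (smul_eq_zero.1 h0).resolve_left hε.ne'

theorem IsCycle.stronglyConnected_of_converges (hG : G.IsCycle) (hH : ContDiff ℝ 2 H)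
    (hHess : ∀ x, (hessianMatrix H x).PosDef) (hrad : Tendsto H (cocompact (V → ℝ)) atTop)
    (hlt : ∀ e, um e < up e) (hum : ∀ e, 0 ≤ um e)
    (hconv : ∀ (x : ℝ → V → ℝ) (xc : ℝ → E → ℝ), G.IsTrajectory H um up x xc →
      ConvergesToSet (fun t => (x t, xc t)) (G.loadBalancingSet H um up)) :
    G.StronglyConnected := by
  by_contra hs
  obtain ⟨x, xc, htraj⟩ := G.exists_isTrajectory hH hlt
  obtain ⟨q, -, hq⟩ := (hconv x xc htraj).nonempty
  set u := sat (-q.2) um up with hu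
  have humu : ∀ e, um e ≤ u e := fun e => (sat_mem_Icc hlt _ e).1
  obtain ⟨p, hp, hp0⟩ := hG.exists_transpose_incidence_mulVec_nonneg hs
  obtain ⟨e₀, he₀⟩ : ∃ e, (G.incidenceᵀ *ᵥ p) e ≠ 0 := by
    by_contra! h
    exact hp0 (funext h)
  -- A vanishing sum of nonnegative terms: `u` is zero on every edge where `Bᵀp` is not, hence on
  -- the whole cycle, which forces `um = 0`.
  have hsum : (G.incidenceᵀ *ᵥ p) ⬝ᵥ u = 0 := by
    rw [← dotProduct_incidence_mulVec, hq, dotProduct_zero]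
  have hue₀ : u e₀ = 0 := by
    have := (Finset.sum_eq_zero_iff_of_nonneg fun e _ =>
      mul_nonneg (hp e) ((hum e).trans (humu e))).1 hsum e₀ (Finset.mem_univ _)
    exact (mul_eq_zero.1 this).resolve_left he₀
  have hu0 : u = 0 := hG.eq_zero_of_incidence_mulVec_eq_zero hq hue₀
  have hum0 : ∀ e, um e = 0 := fun e => le_antisymm ((humu e).trans_eq (congrFun hu0 e)) (hum e)
  refine hp0 (transpose_incidence_mulVec_eq_zero_of_drift hH hHess hrad hconv
    (u := 0) (mulVec_zero _) p fun t ht => funext fun e => ?_)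
  rw [sat_eq_of_le, hum0, Pi.zero_apply]
  rw [hum0]
  simpa using mul_nonneg ht (hp e)

theorem IsCycle.lt_of_converges (hG : G.IsCycle) (hs : G.StronglyConnected)
    (hH : ContDiff ℝ 2 H) (hHess : ∀ x, (hessianMatrix H x).PosDef)
    (hrad : Tendsto H (cocompact (V → ℝ)) atTop) (hlt : ∀ e, um e < up e)
    (hconv : ∀ (x : ℝ → V → ℝ) (xc : ℝ → E → ℝ), G.IsTrajectory H um up x xc →
      ConvergesToSet (fun t => (x t, xc t)) (G.loadBalancingSet H um up)) (i j : E) :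
    um i < up j := by
  classical
  by_contra! hij
  obtain ⟨x, xc, htraj⟩ := G.exists_isTrajectory hH hlt
  obtain ⟨q, -, hq⟩ := (hconv x xc htraj).nonempty
  set u := sat (-q.2) um up with hu
  have hmem : ∀ e, u e ∈ Icc (um e) (up e) := sat_mem_Icc hlt _
  have huij : u i = u j := hG.eq_const_of_incidence_mulVec_eq_zero hs hq i j
  have hui : u i = um i := le_antisymm ((huij.trans_le (hmem j).2).trans hij) (hmem i).1
  have huj : u j = up j := le_antisymm (hmem j).2 (hij.trans ((hmem i).1.trans_eq huij))
  have hne : i ≠ j := by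
    rintro rfl
    exact (hlt i).not_ge hij
  obtain ⟨p, hp⟩ := hG.exists_transpose_incidence_mulVec_eq hs i j
  -- The drift pushes edge `i`, already at its lower bound, down and edge `j`, already at its upper
  -- bound, up; the other edges do not move.
  have h0 := transpose_incidence_mulVec_eq_zero_of_drift hH hHess hrad hconv hq p
    fun t ht => funext fun e => by
      rw [hp]
      rcases eq_or_ne e i with rfl | hei
      · rw [sat_eq_of_le, hui]
        simp [hne, hui, ht]
      rcases eq_or_ne e j with rfl | hej
      · rw [sat_eq_of_ge hlt, huj]
        simp [hei, huj, ht]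
      · have : (u - t • (Pi.single i 1 - Pi.single j 1 : E → ℝ)) e = u e := by
          simp [hei, hej]
        rw [sat_eq_self hlt (this ▸ hmem e), this]
  have := congrFun h0 i
  rw [hp] at this
  simp [hne] at this

end FlowGraph

end

theorem lemma2 {V E : Type*} [Fintype V] [DecidableEq V] [Fintype E]
    (G : FlowGraph V E) (hG : G.IsCycle)
    (H : (V → ℝ) → ℝ) (hH : ContDiff ℝ 2 H)
    (hHess : ∀ x, (hessianMatrix H x).PosDef)
    (hrad : Tendsto H (cocompact (V → ℝ)) atTop)
    (um up : E → ℝ) (hlt : ∀ e, um e < up e)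
    (hcomp : CompatibleWithConstraints um up) :
    (∀ (x : ℝ → V → ℝ) (xc : ℝ → E → ℝ), G.IsTrajectory H um up x xc →
        ConvergesToSet (fun t => (x t, xc t)) (G.loadBalancingSet H um up)) ↔
      G.StronglyConnected ∧ (interior (⋂ e, Icc (um e) (up e))).Nonempty := by
  have hne : Nonempty E := hG.nonempty_edges
  have hV : Nonempty V := hne.map G.head
  rw [nonempty_interior_iInter_Icc_iff]
  constructor
  · intro hconv
    have hs := hG.stronglyConnected_of_converges hH hHess hrad hlt hcomp.2 hconv
    exact ⟨hs, hG.lt_of_converges hs hH hHess hrad hlt hconv⟩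
  · rintro ⟨hs, hint⟩ x xc htraj
    obtain ⟨c, hc⟩ := exists_forall_mem_Ioo hint
    exact htraj.convergesToSet hs hH hHess hrad hc (hG.incidence_mulVec_const hs c)
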